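/- Let $g \ge 13$ be an integer. Then the symplectic group $\mathrm{Sp}\big(2\lfloor\tfrac{g-1}{2}\rfloor;\mathbb{Z}_2\big)$, that is, the group of all $2h\times 2h$ matrices $A$ over the field $\mathbb{Z}_2 = \mathbb{Z}/2\mathbb{Z}$ with $h=\lfloor\tfrac{g-1}{2}\rfloor$ and $AJA^{T}=J$, where $J=\begin{pmatrix}0&-I_h\\ I_h&0\end{pmatrix}$, is generated by three elements $a,b,t$ such that $a$ and $b$ are distinct involutions (elements of order exactly $2$) and $t$ has order exactly $g$ if $g$ is odd, and exactly $g-1$ if $g$ is even. -/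

import Mathlib

open Matrix Equiv

namespace SympTwo

/-! Put h = ⌊(g-1)/2⌋. The space F_2^{2h} contains 2h+1 vectors `frame i`, pairwise non-orthogonal,
and every vector is a sum of evenly many of them. The symmetric group on the frame therefore acts by
symplectic matrices, a transposition being the transvection along a sum of two frame vectors
(`transvection_frame_mulVec`).

Take t to be the (2h+1)-cycle, and a, b the transvections along sums of two adjacent and of four
frame vectors. Then t and a generate all frame permutations. Conjugation yields the transvections
along all sums of two or four, and `transvection_add_mem` reaches longer even sums
(`eq_top_of_framePerm_eq_top`). All transvections are obtained, and these generate the group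
(`eq_top_of_transvection_mem`). -/

theorem eq_one_of_ne_zero {c : ZMod 2} (hc : c ≠ 0) : c = 1 := by
  revert c; decide

theorem vec_add_self {ι : Type*} (x : ι → ZMod 2) : x + x = 0 :=
  funext fun _ => CharTwo.add_self_eq_zero _

theorem vec_add_add_cancel {ι : Type*} (x y : ι → ZMod 2) : x + (x + y) = y := by
  rw [← add_assoc, vec_add_self, zero_add]

/-! ### The symplectic form over F_2 -/

variable {l : Type*} [Fintype l]

/-- The standard symplectic form over the field with two elements. -/
def form (x y : l ⊕ l → ZMod 2) : ZMod 2 :=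
  ∑ i, (x (.inl i) * y (.inr i) + x (.inr i) * y (.inl i))

theorem form_add_left (x y z : l ⊕ l → ZMod 2) : form (x + y) z = form x z + form y z := by
  simp only [form, Pi.add_apply, ← Finset.sum_add_distrib]
  exact Finset.sum_congr rfl fun _ _ => by ring

theorem form_comm (x y : l ⊕ l → ZMod 2) : form x y = form y x :=
  Finset.sum_congr rfl fun _ _ => by ring

theorem form_add_right (x y z : l ⊕ l → ZMod 2) : form x (y + z) = form x y + form x z := by
  rw [form_comm, form_add_left, form_comm y, form_comm z]

theorem form_smul_left (c : ZMod 2) (x y : l ⊕ l → ZMod 2) : form (c • x) y = c * form x y := by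
  simp only [form, Pi.smul_apply, smul_eq_mul, Finset.mul_sum]
  exact Finset.sum_congr rfl fun _ _ => by ring

theorem form_smul_right (c : ZMod 2) (x y : l ⊕ l → ZMod 2) : form x (c • y) = c * form x y := by
  rw [form_comm, form_smul_left, form_comm]

theorem form_self (x : l ⊕ l → ZMod 2) : form x x = 0 :=
  Finset.sum_eq_zero fun i _ => by rw [mul_comm, CharTwo.add_self_eq_zero]

theorem form_zero_left (y : l ⊕ l → ZMod 2) : form 0 y = 0 := by simp [form]

theorem form_sum_left {ι : Type*} (s : Finset ι) (f : ι → l ⊕ l → ZMod 2) (y : l ⊕ l → ZMod 2) :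
    form (∑ i ∈ s, f i) y = ∑ i ∈ s, form (f i) y := by
  classical
  induction s using Finset.induction_on with
  | empty => simp [form_zero_left]
  | insert a s ha ih => rw [Finset.sum_insert ha, Finset.sum_insert ha, form_add_left, ih]

variable [DecidableEq l]

theorem form_eq_dotProduct (x y : l ⊕ l → ZMod 2) : form x y = x ⬝ᵥ J l (ZMod 2) *ᵥ y := by
  simp [form, J, dotProduct, Fintype.sum_sum_type, Finset.sum_add_distrib, fromBlocks_mulVec,
    neg_mulVec, CharTwo.neg_eq]

theorem exists_form_eq_one {x : l ⊕ l → ZMod 2} (hx : x ≠ 0) : ∃ y, form x y = 1 := by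
  obtain ⟨i, hi⟩ := Function.ne_iff.1 hx
  have h1 : x i = 1 := eq_one_of_ne_zero hi
  rcases i with i | i
  · exact ⟨Pi.single (.inr i) 1, by simp [form, Pi.single_apply, h1]⟩
  · exact ⟨Pi.single (.inl i) 1, by simp [form, Pi.single_apply, h1]⟩

theorem form_mulVec (A : symplecticGroup l (ZMod 2)) (x y : l ⊕ l → ZMod 2) :
    form (A.1 *ᵥ x) (A.1 *ᵥ y) = form x y := by
  conv_rhs => rw [form_eq_dotProduct, ← SymplecticGroup.mem_iff'.1 A.2,
    ← mulVec_mulVec, ← mulVec_mulVec, dotProduct_mulVec x, vecMul_transpose]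
  rw [form_eq_dotProduct]

theorem ext_mulVec {A B : symplecticGroup l (ZMod 2)} (h : ∀ x, A.1 *ᵥ x = B.1 *ᵥ x) : A = B :=
  Subtype.ext (mulVec_injective (funext h))

theorem coe_mul_mulVec (A B : symplecticGroup l (ZMod 2)) (x : l ⊕ l → ZMod 2) :
    (A * B).1 *ᵥ x = A.1 *ᵥ B.1 *ᵥ x := by
  rw [mulVec_mulVec]; rfl

theorem coe_one_mulVec (x : l ⊕ l → ZMod 2) :
    (1 : symplecticGroup l (ZMod 2)).1 *ᵥ x = x := one_mulVec x

theorem inv_mulVec_mulVec (A : symplecticGroup l (ZMod 2)) (x : l ⊕ l → ZMod 2) :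
    (A⁻¹).1 *ᵥ A.1 *ᵥ x = x := by
  rw [← coe_mul_mulVec, inv_mul_cancel, coe_one_mulVec]

theorem mulVec_inv_mulVec (A : symplecticGroup l (ZMod 2)) (x : l ⊕ l → ZMod 2) :
    A.1 *ᵥ (A⁻¹).1 *ᵥ x = x := by
  rw [← coe_mul_mulVec, mul_inv_cancel, coe_one_mulVec]

/-! ### Transvections and generation by them -/

theorem transvection_mulVec_aux (v x : l ⊕ l → ZMod 2) :
    (1 + vecMulVec v (v ᵥ* J l (ZMod 2))) *ᵥ x = x + form v x • v := by
  rw [add_mulVec, one_mulVec, vecMulVec_mulVec, form_eq_dotProduct, dotProduct_mulVec]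
  simp

/-- The symplectic transvection along `v`. -/
def transvection (v : l ⊕ l → ZMod 2) : symplecticGroup l (ZMod 2) :=
  ⟨1 + vecMulVec v (v ᵥ* J l (ZMod 2)), by
    rw [SymplecticGroup.mem_iff']
    have key : ∀ x y : l ⊕ l → ZMod 2,
        x ⬝ᵥ ((1 + vecMulVec v (v ᵥ* J l (ZMod 2)))ᵀ * J l (ZMod 2) *
          (1 + vecMulVec v (v ᵥ* J l (ZMod 2)))) *ᵥ y = x ⬝ᵥ J l (ZMod 2) *ᵥ y := by
      intro x y
      rw [← mulVec_mulVec, ← mulVec_mulVec, dotProduct_mulVec x, vecMul_transpose,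
        ← form_eq_dotProduct, ← form_eq_dotProduct, transvection_mulVec_aux,
        transvection_mulVec_aux]
      simp only [form_add_left, form_add_right, form_smul_left, form_smul_right, form_self]
      rw [form_comm x v]
      linear_combination CharTwo.add_self_eq_zero (form v x * form v y)
    refine mulVec_injective (funext fun y => ?_)
    exact dotProduct_eq _ _ fun x => by rw [dotProduct_comm, key, dotProduct_comm]⟩

theorem transvection_mulVec (v x : l ⊕ l → ZMod 2) :
    (transvection v).1 *ᵥ x = x + form v x • v :=
  transvection_mulVec_aux v x

theorem transvection_mul_self (v : l ⊕ l → ZMod 2) : transvection v * transvection v = 1 := by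
  refine ext_mulVec fun x => ?_
  rw [coe_mul_mulVec, coe_one_mulVec, transvection_mulVec, transvection_mulVec, form_add_right,
    form_smul_right, form_self, mul_zero, add_zero, add_assoc, ← add_smul,
    CharTwo.add_self_eq_zero, zero_smul, add_zero]

theorem transvection_ne_one {v : l ⊕ l → ZMod 2} (hv : v ≠ 0) : transvection v ≠ 1 := by
  intro h
  obtain ⟨y, hy⟩ := exists_form_eq_one hv
  have := transvection_mulVec v y
  rw [h, coe_one_mulVec, hy, one_smul, left_eq_add] at this
  exact hv this

theorem orderOf_transvection {v : l ⊕ l → ZMod 2} (hv : v ≠ 0) : orderOf (transvection v) = 2 :=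
  orderOf_eq_prime (by rw [pow_two, transvection_mul_self]) (transvection_ne_one hv)

theorem conj_transvection (A : symplecticGroup l (ZMod 2)) (v : l ⊕ l → ZMod 2) :
    A * transvection v * A⁻¹ = transvection (A.1 *ᵥ v) := by
  refine ext_mulVec fun x => ?_
  rw [coe_mul_mulVec, coe_mul_mulVec, transvection_mulVec, transvection_mulVec, mulVec_add,
    mulVec_smul, mulVec_inv_mulVec]
  conv_rhs => rw [← mulVec_inv_mulVec A x, form_mulVec, mulVec_inv_mulVec]

theorem transvection_injective : Function.Injective (transvection (l := l)) := by
  intro v w h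
  have key : ∀ x, form v x • v = form w x • w := fun x => by
    have := transvection_mulVec v x
    rwa [h, transvection_mulVec, add_right_inj, eq_comm] at this
  by_cases hv : v = 0
  · by_contra hne
    exact transvection_ne_one (v := w) (by rintro rfl; exact hne hv)
      (by rw [← h, hv]; exact ext_mulVec fun x => by
            rw [transvection_mulVec, smul_zero, add_zero, coe_one_mulVec])
  · obtain ⟨y, hy⟩ := exists_form_eq_one hv
    have := key y
    rw [hy, one_smul] at this
    have h2 : form w y ≠ 0 := fun h0 => hv (by rw [this, h0, zero_smul])
    rwa [eq_one_of_ne_zero h2, one_smul] at this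

/-- If `u` and `v` are not orthogonal, the transvection along `u + v` takes `u` to `v`. -/
theorem transvection_add_mulVec {u v : l ⊕ l → ZMod 2} (h : form u v = 1) :
    (transvection (u + v)).1 *ᵥ u = v := by
  rw [transvection_mulVec, form_add_left, form_self, zero_add, form_comm, h, one_smul,
    vec_add_add_cancel]

/-- If `u` and `v` are not orthogonal, the transvection along `u` takes `v` to `u + v`. -/
theorem transvection_mulVec_of_form {u v : l ⊕ l → ZMod 2} (h : form u v = 1) :
    (transvection u).1 *ᵥ v = u + v := by
  rw [transvection_mulVec, h, one_smul, add_comm]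

theorem transvection_mulVec_of_form_eq_zero {u v : l ⊕ l → ZMod 2} (h : form u v = 0) :
    (transvection u).1 *ᵥ v = v := by
  rw [transvection_mulVec, h, zero_smul, add_zero]

/-- A transvection along a vector `A y + y` thus leaves the fixed vectors of `A` alone, which is why
only such directions are used to correct `A`. -/
theorem form_mulVec_add_self (A : symplecticGroup l (ZMod 2)) {x : l ⊕ l → ZMod 2}
    (y : l ⊕ l → ZMod 2) (hx : A.1 *ᵥ x = x) : form (A.1 *ᵥ y + y) x = 0 := by
  have := form_mulVec A y x
  rw [hx] at this
  rw [form_add_left, this, CharTwo.add_self_eq_zero]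

/-- A nontrivial symplectic matrix can be multiplied by transvections to fix more vectors. -/
theorem exists_mul_fix_more {S : Subgroup (symplecticGroup l (ZMod 2))}
    (hS : ∀ v, transvection v ∈ S) {A : symplecticGroup l (ZMod 2)} (hA : A ≠ 1) :
    ∃ B ∈ S, (∀ x, A.1 *ᵥ x = x → (B * A).1 *ᵥ x = x) ∧
      ∃ u, A.1 *ᵥ u ≠ u ∧ (B * A).1 *ᵥ u = u := by
  by_cases h : ∃ x, form (A.1 *ᵥ x) x = 1
  · obtain ⟨u, hu⟩ := h
    refine ⟨transvection (A.1 *ᵥ u + u), hS _, fun x hx => ?_, u, fun h => ?_, ?_⟩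
    · rw [coe_mul_mulVec, hx, transvection_mulVec_of_form_eq_zero (form_mulVec_add_self A u hx)]
    · rw [h, form_self] at hu
      exact zero_ne_one hu
    · rw [coe_mul_mulVec, transvection_add_mulVec hu]
  · have h0 : ∀ x, form (A.1 *ᵥ x) x = 0 := fun x => by
      by_contra hx
      exact h ⟨x, eq_one_of_ne_zero hx⟩
    -- Polarization of the identity `h0`.
    have hsymm : ∀ x y, form (A.1 *ᵥ x) y = form x (A.1 *ᵥ y) := fun x y => by
      have := h0 (x + y)
      rw [mulVec_add, form_add_left, form_add_right, form_add_right, h0, h0, zero_add, add_zero,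
        CharTwo.add_eq_zero] at this
      rw [this, form_comm]
    obtain ⟨u, hu⟩ : ∃ u, A.1 *ᵥ u ≠ u := by
      by_contra! hne
      exact hA (ext_mulVec fun x => by rw [hne, coe_one_mulVec])
    -- `A u` and `u` are orthogonal, so no single transvection links them. The vector `A w + w + u`
    -- is non-orthogonal to both and serves as a stopover.
    obtain ⟨w, hw⟩ := exists_form_eq_one (x := A.1 *ᵥ u + u)
      (fun h => hu (add_right_cancel (h.trans (vec_add_self u).symm)))
    rw [form_add_left] at hw
    have h1 : form (A.1 *ᵥ u) ((A.1 *ᵥ w + w) + u) = 1 := by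
      rw [form_add_right, form_add_right, form_mulVec, h0, add_zero, ← hw, add_comm]
    have h2 : form ((A.1 *ᵥ w + w) + u) u = 1 := by
      rw [form_add_left, form_self, add_zero, form_comm, form_add_right, ← hsymm, hw]
    refine ⟨transvection ((A.1 *ᵥ w + w) + u + u) *
      transvection (A.1 *ᵥ u + ((A.1 *ᵥ w + w) + u)), S.mul_mem (hS _) (hS _), fun x hx => ?_,
      u, hu, ?_⟩
    · have h3 : form (A.1 *ᵥ u + ((A.1 *ᵥ w + w) + u)) x = 0 := by
        rw [add_left_comm, form_add_left, form_mulVec_add_self A w hx,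
          form_mulVec_add_self A u hx, add_zero]
      have h4 : form ((A.1 *ᵥ w + w) + u + u) x = 0 := by
        rw [add_assoc _ u, vec_add_self, add_zero, form_mulVec_add_self A w hx]
      rw [coe_mul_mulVec, coe_mul_mulVec, hx, transvection_mulVec_of_form_eq_zero h3,
        transvection_mulVec_of_form_eq_zero h4]
    · rw [coe_mul_mulVec, coe_mul_mulVec, transvection_add_mulVec h1, transvection_add_mulVec h2]

/-- Symplectic transvections generate the symplectic group over the field with two elements. -/
theorem eq_top_of_transvection_mem {S : Subgroup (symplecticGroup l (ZMod 2))}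
    (hS : ∀ v, transvection v ∈ S) : S = ⊤ := by
  rw [Subgroup.eq_top_iff']
  intro A
  induction hn : (Finset.univ.filter fun x => A.1 *ᵥ x ≠ x).card using Nat.strong_induction_on
    generalizing A with
  | _ n ih =>
    by_cases hA : A = 1
    · rw [hA]; exact S.one_mem
    · obtain ⟨B, hB, hfix, u, hu, hBu⟩ := exists_mul_fix_more hS hA
      rw [← S.mul_mem_cancel_left hB]
      refine ih _ ?_ _ rfl
      rw [← hn]
      refine Finset.card_lt_card (Finset.ssubset_iff_of_subset (fun x => ?_) |>.2 ⟨u, ?_, ?_⟩)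
      · simpa using fun h1 h2 => h1 (hfix x h2)
      · simpa using hu
      · simpa using hBu


theorem transvection_zero {l : Type*} [Fintype l] [DecidableEq l] :
    transvection (0 : l ⊕ l → ZMod 2) = 1 :=
  ext_mulVec fun x => by rw [transvection_mulVec, smul_zero, add_zero, coe_one_mulVec]

theorem transvection_add_mem {l : Type*} [Fintype l] [DecidableEq l]
    {S : Subgroup (symplecticGroup l (ZMod 2))} {u v : l ⊕ l → ZMod 2}
    (hu : transvection u ∈ S) (hv : transvection v ∈ S) (h : form u v = 1) :
    transvection (u + v) ∈ S := by
  rw [← transvection_mulVec_of_form h, ← conj_transvection]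
  exact S.mul_mem (S.mul_mem hu hv) (S.inv_mem hu)

/-! ### A frame permuted by the symmetric group -/

variable {h : ℕ}

/-- Vectors that are pairwise non-orthogonal for the symplectic form. -/
def frame (i : Fin (2 * h + 1)) : Fin h ⊕ Fin h → ZMod 2 :=
  Sum.elim (fun j => if 2 * (j : ℕ) ≤ i ∧ (i : ℕ) ≠ 2 * j + 1 then 1 else 0)
    (fun j => if 2 * (j : ℕ) < i then 1 else 0)

theorem form_frame_of_lt {i j : Fin (2 * h + 1)} (hij : i < j) : form (frame i) (frame j) = 1 := by
  have hij' : (i : ℕ) < j := hij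
  have hj := j.isLt
  -- In block `k`, the vector `frame i` is (0,0), (1,0), (0,1) or (1,1) according as `i < 2k`, `i =
  -- 2k`, `i = 2k+1` or `i > 2k+1`. For `i < j`, lower blocks are both (1,1), higher ones vanish for
  -- `i`, and block `i / 2` holds two distinct nonzero vectors.
  rw [form, Finset.sum_eq_single ⟨i / 2, by omega⟩]
  · obtain ⟨k, hi | hi⟩ := Nat.even_or_odd' (i : ℕ)
    all_goals
      simp only [frame, Sum.elim_inl, Sum.elim_inr]
      split_ifs <;> first | omega | decide
  · intro k _ hk
    have hk' : (k : ℕ) ≠ i / 2 := fun h => hk (Fin.ext h)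
    simp only [frame, Sum.elim_inl, Sum.elim_inr]
    split_ifs <;> first | omega | decide
  · simp

theorem form_frame (i j : Fin (2 * h + 1)) :
    form (frame i) (frame j) = 1 + if i = j then 1 else 0 := by
  rcases lt_trichotomy i j with hij | rfl | hij
  · rw [form_frame_of_lt hij, if_neg hij.ne, add_zero]
  · rw [form_self, if_pos rfl]; decide
  · rw [form_comm, form_frame_of_lt hij, if_neg hij.ne', add_zero]

/-- Evenness kills the constant term of `form_frame`, so pairing with the frame reads off the set.
-/
theorem form_sum_frame {S : Finset (Fin (2 * h + 1))} (hS : Even S.card) (i : Fin (2 * h + 1)) :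
    form (∑ j ∈ S, frame j) (frame i) = if i ∈ S then 1 else 0 := by
  simp only [form_sum_left, form_frame, Finset.sum_add_distrib, Finset.sum_const, nsmul_one,
    (ZMod.natCast_eq_zero_iff_even).2 hS, zero_add, Finset.sum_ite_eq']

theorem sum_frame_injective {S R : Finset (Fin (2 * h + 1))} (hS : Even S.card)
    (hR : Even R.card) (hSR : ∑ j ∈ S, frame j = ∑ j ∈ R, frame j) : S = R := by
  ext i
  have := form_sum_frame hS i
  rw [hSR, form_sum_frame hR i] at this
  by_cases h1 : i ∈ S <;> by_cases h2 : i ∈ R <;> simp_all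

/-- The even subset of `Fin (n + 1)` that agrees with `S` except possibly at the last element. -/
def evenExtension {n : ℕ} (S : Finset (Fin n)) : Finset (Fin (n + 1)) :=
  if Even S.card then S.map Fin.castSuccEmb else insert (Fin.last n) (S.map Fin.castSuccEmb)

theorem even_card_evenExtension {n : ℕ} (S : Finset (Fin n)) : Even (evenExtension S).card := by
  unfold evenExtension
  split_ifs with hS
  · rwa [Finset.card_map]
  · rw [Finset.card_insert_of_notMem (by simp [Fin.castSucc_ne_last]), Finset.card_map]
    exact (Nat.not_even_iff_odd.1 hS).add_one

theorem castSucc_mem_evenExtension {n : ℕ} {S : Finset (Fin n)} {i : Fin n} :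
    i.castSucc ∈ evenExtension S ↔ i ∈ S := by
  unfold evenExtension
  split_ifs <;> simp [Fin.castSucc_ne_last]

/-- Every vector is the sum of the frame over a set of even cardinality. -/
theorem exists_eq_sum_frame (v : Fin h ⊕ Fin h → ZMod 2) :
    ∃ S : Finset (Fin (2 * h + 1)), Even S.card ∧ ∑ j ∈ S, frame j = v := by
  let φ : Finset (Fin (2 * h)) → Fin h ⊕ Fin h → ZMod 2 := fun S => ∑ j ∈ evenExtension S, frame j
  have hφ : Function.Injective φ := fun S R hSR => by
    have := sum_frame_injective (even_card_evenExtension S) (even_card_evenExtension R) hSR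
    ext i
    rw [← castSucc_mem_evenExtension, this, castSucc_mem_evenExtension]
  -- Both sides have 2^{2h} elements.
  have hb := (Fintype.bijective_iff_injective_and_card φ).2 ⟨hφ, by simp [two_mul, ZMod.card]⟩
  obtain ⟨S, hS⟩ := hb.2 v
  exact ⟨_, even_card_evenExtension S, hS⟩

theorem mulVec_sum_frame {A : symplecticGroup (Fin h) (ZMod 2)} {σ : Perm (Fin (2 * h + 1))}
    (hA : ∀ i, A.1 *ᵥ frame i = frame (σ i)) (S : Finset (Fin (2 * h + 1))) :
    A.1 *ᵥ (∑ i ∈ S, frame i) = ∑ i ∈ S, frame (σ i) := by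
  rw [mulVec_sum]
  exact Finset.sum_congr rfl fun i _ => hA i

theorem frame_injective : Function.Injective (frame (h := h)) := by
  intro i j hij
  by_contra hne
  have := form_frame i j
  rw [hij, form_self, if_neg hne] at this
  revert this; decide

theorem eq_one_iff_of_frame {A : symplecticGroup (Fin h) (ZMod 2)} {σ : Perm (Fin (2 * h + 1))}
    (hA : ∀ i, A.1 *ᵥ frame i = frame (σ i)) : A = 1 ↔ σ = 1 := by
  constructor
  · rintro rfl
    exact Equiv.ext fun i => frame_injective (by rw [← hA, coe_one_mulVec, Perm.one_apply])
  · rintro rfl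
    refine ext_mulVec fun v => ?_
    obtain ⟨S, -, rfl⟩ := exists_eq_sum_frame v
    rw [mulVec_sum_frame hA, coe_one_mulVec]
    rfl

/-- The permutations of the frame that are induced by elements of `G`. -/
def framePerm (G : Subgroup (symplecticGroup (Fin h) (ZMod 2))) :
    Subgroup (Perm (Fin (2 * h + 1))) where
  carrier := {σ | ∃ A ∈ G, ∀ i, A.1 *ᵥ frame i = frame (σ i)}
  one_mem' := ⟨1, G.one_mem, fun i => coe_one_mulVec _⟩
  mul_mem' := by
    rintro σ τ ⟨A, hA, hA'⟩ ⟨B, hB, hB'⟩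
    exact ⟨A * B, G.mul_mem hA hB, fun i => by rw [coe_mul_mulVec, hB', hA']; rfl⟩
  inv_mem' := by
    rintro σ ⟨A, hA, hA'⟩
    refine ⟨A⁻¹, G.inv_mem hA, fun i => ?_⟩
    have := hA' (σ⁻¹ i)
    rw [show σ (σ⁻¹ i) = i from σ.apply_symm_apply i] at this
    rw [← this, inv_mulVec_mulVec]

theorem transvection_frame_mulVec {i j : Fin (2 * h + 1)} (hij : i ≠ j) (k : Fin (2 * h + 1)) :
    (transvection (frame i + frame j)).1 *ᵥ frame k = frame (swap i j k) := by
  by_cases hi : k = i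
  · subst hi
    rw [swap_apply_left, transvection_add_mulVec (by rw [form_frame, if_neg hij, add_zero])]
  by_cases hj : k = j
  · subst hj
    rw [swap_apply_right, add_comm,
      transvection_add_mulVec (by rw [form_frame, if_neg hi, add_zero])]
  · rw [swap_apply_of_ne_of_ne hi hj, transvection_mulVec_of_form_eq_zero]
    rw [form_add_left, form_frame, form_frame, if_neg (Ne.symm hi), if_neg (Ne.symm hj)]
    decide

theorem swap_mem_framePerm {G : Subgroup (symplecticGroup (Fin h) (ZMod 2))}
    {i j : Fin (2 * h + 1)} (hij : i ≠ j) (hG : transvection (frame i + frame j) ∈ G) :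
    swap i j ∈ framePerm G :=
  ⟨_, hG, transvection_frame_mulVec hij⟩

/-- Every permutation of the frame is induced by a symplectic matrix. -/
theorem exists_mulVec_frame (σ : Perm (Fin (2 * h + 1))) :
    ∃ A : symplecticGroup (Fin h) (ZMod 2), ∀ i, A.1 *ᵥ frame i = frame (σ i) := by
  have : σ ∈ framePerm (⊤ : Subgroup (symplecticGroup (Fin h) (ZMod 2))) := by
    induction σ using Perm.swap_induction_on with
    | one => exact Subgroup.one_mem _
    | swap_mul τ i j hij ih =>
      exact Subgroup.mul_mem _ (swap_mem_framePerm hij (Subgroup.mem_top _)) ih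
  obtain ⟨A, -, hA⟩ := this
  exact ⟨A, hA⟩

theorem orderOf_eq_of_frame {A : symplecticGroup (Fin h) (ZMod 2)} {σ : Perm (Fin (2 * h + 1))}
    (hA : ∀ i, A.1 *ᵥ frame i = frame (σ i)) : orderOf A = orderOf σ := by
  rw [orderOf_eq_orderOf_iff]
  intro n
  refine eq_one_iff_of_frame ?_
  induction n with
  | zero => intro i; rw [pow_zero, pow_zero, coe_one_mulVec, Perm.one_apply]
  | succ n ih => intro i; rw [pow_succ, pow_succ, coe_mul_mulVec, hA, ih, Perm.mul_apply]

/-! ### Generation by a cycle and two transvections -/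

/-- If `G` induces all permutations of the frame, then whether it contains the transvection along
a sum of frame vectors depends only on the number of summands. -/
theorem transvection_sum_mem_of_card_eq {G : Subgroup (symplecticGroup (Fin h) (ZMod 2))}
    (hG : framePerm G = ⊤) {S R : Finset (Fin (2 * h + 1))} (hSR : S.card = R.card)
    (hS : transvection (∑ i ∈ S, frame i) ∈ G) : transvection (∑ i ∈ R, frame i) ∈ G := by
  let σ : Perm (Fin (2 * h + 1)) := (Finset.equivOfCardEq hSR).extendSubtype
  obtain ⟨A, hA, hA'⟩ : σ ∈ framePerm G := hG ▸ Subgroup.mem_top σ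
  have hσ : S.map σ.toEmbedding = R := by
    refine Finset.eq_of_subset_of_card_le (fun i hi => ?_) (by rw [Finset.card_map, hSR])
    obtain ⟨j, hj, rfl⟩ := Finset.mem_map.1 hi
    exact (Finset.equivOfCardEq hSR).extendSubtype_mem j hj
  have h1 := mulVec_sum_frame hA' S
  have h2 : ∑ i ∈ R, frame i = ∑ i ∈ S, frame (σ i) := by rw [← hσ, Finset.sum_map]; rfl
  rw [h2, ← h1, ← conj_transvection]
  exact G.mul_mem (G.mul_mem hA hS) (G.inv_mem hA)

/-- A subgroup that induces all permutations of the frame and contains a transvection along a sum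
of two and one along a sum of four frame vectors is everything. -/
theorem eq_top_of_framePerm_eq_top {G : Subgroup (symplecticGroup (Fin h) (ZMod 2))}
    (hG : framePerm G = ⊤) {P Q : Finset (Fin (2 * h + 1))} (hP : P.card = 2) (hQ : Q.card = 4)
    (hGP : transvection (∑ i ∈ P, frame i) ∈ G) (hGQ : transvection (∑ i ∈ Q, frame i) ∈ G) :
    G = ⊤ := by
  have key : ∀ (n : ℕ) (S : Finset (Fin (2 * h + 1))), S.card = 2 * n →
      transvection (∑ i ∈ S, frame i) ∈ G := by
    intro n
    induction n with
    | zero =>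
      intro S hS
      rw [Finset.card_eq_zero.1 hS, Finset.sum_empty, transvection_zero]
      exact G.one_mem
    | succ n ih =>
      intro S hS
      by_cases h2 : n = 0
      · exact transvection_sum_mem_of_card_eq hG (by omega) hGP
      by_cases h4 : n = 1
      · exact transvection_sum_mem_of_card_eq hG (by omega) hGQ
      -- `S` has even size and the frame has odd size.
      obtain ⟨d, hd⟩ : ∃ d, d ∉ S := by
        by_contra! hall
        have := congrArg Finset.card (Finset.eq_univ_iff_forall.2 hall)
        rw [Finset.card_univ, Fintype.card_fin] at this
        omega
      obtain ⟨R, hRS, hR⟩ := Finset.exists_subset_card_eq (s := S) (n := 3) (by omega)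
      have hdR : d ∉ R := fun hm => hd (hRS hm)
      have hdS : d ∉ S \ R := fun hm => hd (Finset.mem_sdiff.1 hm).1
      have hc : (insert d R).card = 4 := by rw [Finset.card_insert_of_notMem hdR, hR]
      -- The two sets, of sizes 4 and `S.card - 2`, share only `d`: it cancels in the sum, and the
      -- odd overlap makes the two summands non-orthogonal.
      have hsum : ∑ i ∈ S, frame i =
          ∑ i ∈ insert d R, frame i + ∑ i ∈ insert d (S \ R), frame i := by
        rw [Finset.sum_insert hdR, Finset.sum_insert hdS, ← Finset.sum_sdiff hRS, add_add_add_comm,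
          vec_add_self, zero_add, add_comm]
      rw [hsum]
      refine transvection_add_mem (transvection_sum_mem_of_card_eq hG (hQ.trans hc.symm) hGQ)
        (ih _ ?_) ?_
      · rw [Finset.card_insert_of_notMem hdS, Finset.card_sdiff_of_subset hRS]
        omega
      · rw [form_comm, form_sum_left, Finset.sum_insert hdS, form_comm,
          form_sum_frame (hc ▸ by decide), if_pos (Finset.mem_insert_self _ _),
          Finset.sum_eq_zero, add_zero]
        intro i hi
        obtain ⟨hiS, hiR⟩ := Finset.mem_sdiff.1 hi
        rw [form_comm, form_sum_frame (hc ▸ by decide), if_neg]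
        rw [Finset.mem_insert, not_or]
        exact ⟨fun hid => hd (hid ▸ hiS), hiR⟩
  refine eq_top_of_transvection_mem fun v => ?_
  obtain ⟨S, ⟨n, hn⟩, rfl⟩ := exists_eq_sum_frame v
  exact key n S (by omega)

/-- For `h ≥ 2` the group `Sp(2h, 2)` is generated by two involutions and an element of order
`2h + 1`. -/
theorem exists_generators (hh : 2 ≤ h) : ∃ a b t : symplecticGroup (Fin h) (ZMod 2),
    orderOf a = 2 ∧ orderOf b = 2 ∧ a ≠ b ∧ orderOf t = 2 * h + 1 ∧
      Subgroup.closure {a, b, t} = ⊤ := by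
  have hcycle : (finRotate (2 * h + 1)).IsCycle := isCycle_finRotate_of_le (by omega)
  have hsupp : (finRotate (2 * h + 1)).support = Finset.univ :=
    support_finRotate_of_le (by omega)
  have h01 : (0 : Fin (2 * h + 1)) ≠ finRotate (2 * h + 1) 0 := by
    have : (0 : Fin (2 * h + 1)) ∈ (finRotate (2 * h + 1)).support := hsupp ▸ Finset.mem_univ _
    exact (Perm.mem_support.1 this).symm
  obtain ⟨t, ht⟩ := exists_mulVec_frame (finRotate (2 * h + 1))
  obtain ⟨Q, -, hQ⟩ := Finset.exists_subset_card_eq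
    (s := (Finset.univ : Finset (Fin (2 * h + 1)))) (n := 4)
    (by rw [Finset.card_univ, Fintype.card_fin]; omega)
  obtain ⟨P, hPdef⟩ : ∃ P : Finset (Fin (2 * h + 1)), P = {0, finRotate (2 * h + 1) 0} := ⟨_, rfl⟩
  have hP : P.card = 2 := by rw [hPdef, Finset.card_pair h01]
  have hP2 : Even P.card := ⟨1, hP⟩
  have hQ2 : Even Q.card := ⟨2, hQ⟩
  have hPsum : ∑ i ∈ P, frame i = frame 0 + frame (finRotate (2 * h + 1) 0) := by
    rw [hPdef, Finset.sum_pair h01]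
  have hne : ∀ S : Finset (Fin (2 * h + 1)), Even S.card → S.card ≠ 0 → ∑ i ∈ S, frame i ≠ 0 := by
    intro S hS hS0 h0
    refine hS0 (Finset.card_eq_zero.2 (sum_frame_injective hS (by simp) ?_))
    rw [h0, Finset.sum_empty]
  refine ⟨transvection (∑ i ∈ P, frame i), transvection (∑ i ∈ Q, frame i), t,
    orderOf_transvection (hne P hP2 (by omega)),
    orderOf_transvection (hne Q hQ2 (by omega)), fun hPQ => ?_, ?_, ?_⟩
  · have := sum_frame_injective hP2 hQ2 (transvection_injective hPQ)
    rw [this, hQ] at hP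
    omega
  · rw [orderOf_eq_of_frame ht, hcycle.orderOf, hsupp, Finset.card_univ, Fintype.card_fin]
  · refine eq_top_of_framePerm_eq_top (P := P) (Q := Q) ?_ hP hQ
      (Subgroup.subset_closure (by simp)) (Subgroup.subset_closure (by simp))
    -- A full cycle and a transposition of adjacent points generate the symmetric group.
    rw [eq_top_iff, ← Perm.closure_cycle_adjacent_swap hcycle hsupp 0, Subgroup.closure_le]
    rintro σ (rfl | rfl)
    · exact ⟨t, Subgroup.subset_closure (by simp), ht⟩
    · exact swap_mem_framePerm h01 (hPsum ▸ Subgroup.subset_closure (by simp))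

end SympTwo

theorem mainTheorem4 (g : ℕ) (hg : 13 ≤ g) :
    ∃ a b t : Matrix.symplecticGroup (Fin ((g - 1) / 2)) (ZMod 2),
      orderOf a = 2 ∧ orderOf b = 2 ∧ a ≠ b ∧
      (Odd g → orderOf t = g) ∧ (Even g → orderOf t = g - 1) ∧
      Subgroup.closure {a, b, t} = ⊤ := by
  obtain ⟨a, b, t, ha, hb, hab, ht, hgen⟩ :=
    SympTwo.exists_generators (h := (g - 1) / 2) (by omega)
  refine ⟨a, b, t, ha, hb, hab, ?_, ?_, hgen⟩
  -- The order 2⌊(g-1)/2⌋ + 1 is g for odd g and g - 1 for even g.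
  · rintro ⟨k, hk⟩
    omega
  · rintro ⟨k, hk⟩
    omega
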